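/- Let $d\ge 1$ be an integer, $L>0$, and $\mathbb B=\{\pm1\}$. For positive integers $r,k$ let $\mathtt{HAC}(d,r,k)$ be the class of all functions $x\mapsto h(\operatorname{sgn}(W^\top x+b))$ from $\mathbb R^d$ to $\mathbb B$, where $h:\mathbb B^k\to\mathbb B$ is an arbitrary Boolean function, $W\in\mathbb R^{d\times k}$ has rank at most $r$, $b\in\mathbb R^k$, and $\operatorname{sgn}$ acts entrywise with $\operatorname{sgn}(t)=1$ for $t\ge 0$ and $\operatorname{sgn}(t)=-1$ for $t<0$. For a probability distribution $P$ of $(X,Y)$ on $[0,1]^d\times\mathbb B$ let $R_P(f)=P(f(X)\ne Y)$, let $R_P^*$ be the infimum of $R_P(f)$ over all measurable $f:[0,1]^d\to\mathbb B$, and let $\eta_P(x)=P(Y=1\mid X=x)$. Write $\eta_P\in\Sigma(L,[0,1]^d)$ if (a version of) $\eta_P$ satisfies $|\eta_P(x)-\eta_P(x')|\le L\|x-x'\|_2$ for all $x,x'\in[0,1]^d$. Let $k=k(n)$ be a sequence of positive integers with $k(n)\asymp n^{1/(d+2)}$, that is, there are $\alpha,\beta>0$ with $\alpha n^{1/(d+2)}\le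 k(n)\le\beta n^{1/(d+2)}$ for all $n\ge1$. Then there is a constant $C'$, independent of $n$, such that for every $n\ge 1$ and every empirical risk minimizer $\hat f_n$ over $\mathtt{HAC}(d,d,k(n))$ (a map that assigns to each sample $(x_1,y_1),\dots,(x_n,y_n)$ in $[0,1]^d\times\mathbb B$ a member of the class, restricted to $[0,1]^d$, that minimizes $f\mapsto\frac1n\sum_{i=1}^n\mathbb I\{f(x_i)\ne y_i\}$ over the class), \[ \sup_{P\,:\,\eta_P\in\Sigma(L,[0,1]^d)}\Big(\mathbb E\big[R_P(\hat f_n)\big]-R_P^*\Big)\le C'\,n^{-\frac1{d+2}}, \] where the expectation is over $n$ i.i.d. draws from $P$. -/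

import Mathlib

open MeasureTheory

noncomputable section

namespace HANN

/-- The label set `{±1}`. -/
abbrev Label : Type := ℤˣ

/-- Every set of labels is measurable. -/
instance : DiscreteMeasurableSpace Label where
  forall_measurableSet s :=
    ⟨Units.val '' s, MeasurableSet.of_discrete, Set.preimage_image_eq s Units.val_injective⟩

/-- The sign function with `sgn 0 = 1`. -/
def sgn (t : ℝ) : Label := if 0 ≤ t then 1 else -1

/-- The sign vector `sgn (Wᵀ x + b)` of `x` in the arrangement of `k` hyperplanes given by `W, b`. -/
def signVector {d k : ℕ} (W : Matrix (Fin d) (Fin k) ℝ) (b : Fin k → ℝ)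
    (x : EuclideanSpace ℝ (Fin d)) : Fin k → Label :=
  fun j => sgn ((W.transpose.mulVec x.ofLp + b) j)

/-- The class of hyperplane arrangement classifiers on `ℝ^d`. -/
def HAC (d r k : ℕ) : Set (EuclideanSpace ℝ (Fin d) → Label) :=
  {f | ∃ (h : (Fin k → Label) → Label) (W : Matrix (Fin d) (Fin k) ℝ) (b : Fin k → ℝ),
    W.rank ≤ r ∧ f = h ∘ signVector W b}

/-- The cube `[0,1]^d`, with the Euclidean distance. -/
abbrev UnitCube (d : ℕ) : Type :=
  {x : EuclideanSpace ℝ (Fin d) // ∀ i, x i ∈ Set.Icc (0 : ℝ) 1}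

/-- The class `HAC` regarded as a concept class over the feature space `[0,1]^d`. -/
def cubeHAC (d r k : ℕ) : Set (UnitCube d → Label) :=
  {f | ∃ g ∈ HAC d r k, ∀ x : UnitCube d, f x = g x}

section Risk

variable {X : Type} [MeasurableSpace X]

/-- The risk `P (f(X) ≠ Y)`. -/
def risk (P : Measure (X × Label)) (f : X → Label) : ℝ :=
  P.real {z | f z.1 ≠ z.2}

/-- The Bayes risk, the infimum of the risk over all measurable classifiers. -/
def bayesRisk (P : Measure (X × Label)) : ℝ :=
  ⨅ f : {f : X → Label // Measurable f}, risk P f.1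

/-- `η` is a version of `x ↦ P (Y = 1 | X = x)`. -/
def IsPosterior (P : Measure (X × Label)) (η : X → ℝ) : Prop :=
  Integrable η P.fst ∧
    ∀ A : Set X, MeasurableSet A → P.real (A ×ˢ {(1 : Label)}) = ∫ x in A, η x ∂P.fst

/-- The expected risk of a learning algorithm trained on `n` i.i.d. draws from `P`. -/
def expectedRisk (P : Measure (X × Label)) {n : ℕ} (A : (Fin n → X × Label) → X → Label) : ℝ :=
  ∫ s, risk P (A s) ∂(Measure.pi fun _ : Fin n => P)

end Risk

/-- The empirical risk of `f` on the sample `s`. -/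
def empiricalRisk {X : Type} {n : ℕ} (s : Fin n → X × Label) (f : X → Label) : ℝ :=
  (1 / (n : ℝ)) * ∑ i, if f (s i).1 ≠ (s i).2 then 1 else 0

/-- The learning algorithm `A` is an empirical risk minimizer over the concept class `C`. -/
def IsERM {X : Type} {n : ℕ} (C : Set (X → Label)) (A : (Fin n → X × Label) → X → Label) : Prop :=
  ∀ s, A s ∈ C ∧ ∀ g ∈ C, empiricalRisk s (A s) ≤ empiricalRisk s g

/-- The class `Σ(L, [0,1]^d)` of `L`-Lipschitz functions on the cube. -/
def lipschitzClass (L : ℝ) (d : ℕ) : Set (UnitCube d → ℝ) :=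
  {f | ∀ x x' : UnitCube d, |f x - f x'| ≤ L * ‖x.1 - x'.1‖}

/-- `f ≍ g` for functions on the positive integers. -/
def Asymp (f g : ℕ → ℝ) : Prop :=
  ∃ α β : ℝ, 0 < α ∧ 0 < β ∧ ∀ n : ℕ, 1 ≤ n → α * g n ≤ f n ∧ f n ≤ β * g n

end HANN

end

noncomputable section

namespace HANN

open MeasureTheory

section Patterns

open Finset

lemma sgn_of_nonneg {t : ℝ} (h : 0 ≤ t) : sgn t = 1 := if_pos h

lemma sgn_of_neg {t : ℝ} (h : t < 0) : sgn t = -1 := if_neg (not_le.mpr h)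

lemma label_one_ne_neg_one : (1 : Label) ≠ -1 := by decide

lemma sgn_eq_one_iff {t : ℝ} : sgn t = 1 ↔ 0 ≤ t := by
  unfold sgn
  split_ifs with h
  · simp [h]
  · simp [h, label_one_ne_neg_one.symm]

open Classical in
/-- The sign patterns realized by the affine forms `x ↦ a j ⬝ᵥ x + β j` on `ℝ^D`. -/
def signPatterns {ι : Type*} [Fintype ι] {D : ℕ} (a : ι → Fin D → ℝ) (β : ι → ℝ) :
    Finset (ι → Label) :=
  univ.filter fun p => ∃ x : Fin D → ℝ, ∀ j, p j = sgn (a j ⬝ᵥ x + β j)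

open Classical in
/-- The sets of indices on which the realized sign patterns are positive. -/
def positiveSets {ι : Type*} [Fintype ι] {D : ℕ} (a : ι → Fin D → ℝ) (β : ι → ℝ) :
    Finset (Finset ι) :=
  (signPatterns a β).image fun p => univ.filter fun j => p j = 1

open Classical in
lemma not_shatters_of_relation {ι : Type*} [Fintype ι] {D : ℕ} {a : ι → Fin D → ℝ} {β : ι → ℝ}
    {s : Finset ι} (hs : (positiveSets a β).Shatters s) {c : s → ℝ}
    (hc : ∑ j, c j • a j = 0) (hβ : ∑ j, c j * β j ≤ 0)
    (hneg : ∑ j, c j * β j < 0 ∨ ∃ j, c j < 0) : False := by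
  obtain ⟨u, hu, hsu⟩ := hs (t := (univ.filter fun j => 0 < c j).map (Function.Embedding.subtype _))
    (by intro j; simp only [mem_map, mem_filter]; rintro ⟨i, -, rfl⟩; exact i.2)
  obtain ⟨p, hp, rfl⟩ := Finset.mem_image.mp hu
  obtain ⟨x, hx⟩ := (Finset.mem_filter.mp hp).2
  have key : ∀ j : s, 0 ≤ a j ⬝ᵥ x + β j ↔ 0 < c j := by
    intro j
    have := Finset.ext_iff.mp hsu j
    simp only [mem_inter, j.2, true_and, mem_filter, mem_univ, mem_map,
      Function.Embedding.subtype_apply, SetLike.coe_eq_coe, exists_eq_right] at this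
    rw [← sgn_eq_one_iff, ← hx j, this]
  have hsum : ∑ j, c j * (a j ⬝ᵥ x + β j) = ∑ j, c j * β j := by
    have h0 : ∑ j, c j * (a j ⬝ᵥ x) = 0 := by
      have : (∑ j, c j • a j) ⬝ᵥ x = 0 := by rw [hc, zero_dotProduct]
      rw [sum_dotProduct] at this
      simpa [smul_dotProduct] using this
    simp only [mul_add, sum_add_distrib, h0, zero_add]
  have hnn : ∀ j, 0 ≤ c j * (a j ⬝ᵥ x + β j) := by
    intro j
    rcases lt_or_ge 0 (c j) with h | h
    · exact mul_nonneg h.le ((key j).mpr h)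
    · exact mul_nonneg_of_nonpos_of_nonpos h (le_of_lt (by
        by_contra h'
        exact absurd ((key j).mp (not_lt.mp h')) (not_lt.mpr h)))
  have h1 := Finset.sum_nonneg fun j (_ : j ∈ univ) => hnn j
  rcases hneg with h | ⟨j, hj⟩
  · linarith
  · have : 0 < ∑ j, c j * (a j ⬝ᵥ x + β j) := by
      refine Finset.sum_pos' (fun j _ => hnn j) ⟨j, mem_univ _, mul_pos_of_neg_of_neg hj ?_⟩
      by_contra h'
      exact absurd ((key j).mp (not_lt.mp h')) (not_lt.mpr hj.le)
    linarith

open Classical in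
lemma card_le_of_shatters {ι : Type*} [Fintype ι] {D : ℕ} {a : ι → Fin D → ℝ} {β : ι → ℝ}
    {s : Finset ι} (hs : (positiveSets a β).Shatters s) : s.card ≤ D := by
  by_contra! hlt
  have hdep : ¬ LinearIndependent ℝ (fun j : s => a j) := by
    intro h
    have := h.fintype_card_le_finrank
    simp at this
    omega
  obtain ⟨c, hc, j, hj⟩ := Fintype.not_linearIndependent_iff.mp hdep
  have hc' : ∑ j, (-c) j • a j = 0 := by
    simp only [Pi.neg_apply, neg_smul, sum_neg_distrib, hc, neg_zero]
  have hβ' : ∑ j, (-c) j * β j = - ∑ j, c j * β j := by simp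
  rcases lt_trichotomy (∑ j, c j * β j) 0 with h | h | h
  · exact not_shatters_of_relation hs hc h.le (Or.inl h)
  · rcases lt_or_gt_of_ne hj with h' | h'
    · exact not_shatters_of_relation hs hc h.le (Or.inr ⟨j, h'⟩)
    · exact not_shatters_of_relation hs hc' (by rw [hβ', h, neg_zero])
        (Or.inr ⟨j, by simpa using h'⟩)
  · exact not_shatters_of_relation hs hc' (by rw [hβ']; linarith) (Or.inl (by rw [hβ']; linarith))

lemma sum_choose_le_pow (N D : ℕ) : ∑ i ∈ range (D + 1), N.choose i ≤ (N + 1) ^ D := by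
  rw [add_pow]
  refine Finset.sum_le_sum fun i hi => ?_
  rw [one_pow, mul_one]
  exact (Nat.choose_le_pow N i).trans
    (Nat.le_mul_of_pos_right _ (Nat.choose_pos (Nat.lt_succ_iff.mp (Finset.mem_range.mp hi))))

open Classical in
/-- `N` affine forms on `ℝ^D` realize at most `(N + 1) ^ D` sign patterns. -/
lemma card_signPatterns_le {ι : Type*} [Fintype ι] {D : ℕ} (a : ι → Fin D → ℝ) (β : ι → ℝ) :
    (signPatterns a β).card ≤ (Fintype.card ι + 1) ^ D := by
  have hinj : (positiveSets a β).card = (signPatterns a β).card := by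
    refine Finset.card_image_of_injective _ fun p q hpq => funext fun j => ?_
    have := Finset.ext_iff.mp hpq j
    simp only [mem_filter, mem_univ, true_and] at this
    rcases Int.units_eq_one_or (p j) with h | h <;> rcases Int.units_eq_one_or (q j) with h' | h' <;>
      simp_all
  rw [← hinj]
  have hsub : (positiveSets a β).shatterer ⊆
      (range (D + 1)).biUnion fun i => powersetCard i univ := by
    intro s hs
    simp only [mem_biUnion, mem_range, mem_powersetCard, subset_univ, true_and, exists_eq_right']
    exact Nat.lt_succ_of_le (card_le_of_shatters (Finset.mem_shatterer.mp hs))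
  calc _ ≤ _ := Finset.card_le_card_shatterer _
    _ ≤ _ := Finset.card_le_card hsub
    _ ≤ ∑ i ∈ range (D + 1), (powersetCard i (univ : Finset ι)).card := Finset.card_biUnion_le
    _ = ∑ i ∈ range (D + 1), (Fintype.card ι).choose i := by simp [Finset.card_univ]
    _ ≤ _ := sum_choose_le_pow _ _

lemma signVector_apply {d k : ℕ} (W : Matrix (Fin d) (Fin k) ℝ) (b : Fin k → ℝ)
    (x : EuclideanSpace ℝ (Fin d)) (j : Fin k) :
    signVector W b x j = sgn ((∑ i, W i j * x i) + b j) := rfl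

lemma signVector_mem_signPatterns {d k : ℕ} (W : Matrix (Fin d) (Fin k) ℝ) (b : Fin k → ℝ)
    (x : EuclideanSpace ℝ (Fin d)) : signVector W b x ∈ signPatterns (fun j i => W i j) b := by
  simp only [signPatterns, mem_filter, mem_univ, true_and]
  exact ⟨x.ofLp, fun j => rfl⟩

/-- The sign patterns of all affine forms on `n` points of `ℝ^d`. -/
def halfspacePatterns {n d : ℕ} (x : Fin n → EuclideanSpace ℝ (Fin d)) : Finset (Fin n → Label) :=
  signPatterns (fun i => Fin.snoc (α := fun _ => ℝ) (x i).ofLp 1) 0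

lemma card_halfspacePatterns_le {n d : ℕ} (x : Fin n → EuclideanSpace ℝ (Fin d)) :
    (halfspacePatterns x).card ≤ (n + 1) ^ (d + 1) := by
  have := card_signPatterns_le (fun i => Fin.snoc (α := fun _ => ℝ) (x i).ofLp 1) 0
  rwa [Fintype.card_fin] at this

lemma signVector_column_mem {n d k : ℕ} (x : Fin n → EuclideanSpace ℝ (Fin d))
    (W : Matrix (Fin d) (Fin k) ℝ) (b : Fin k → ℝ) (j : Fin k) :
    (fun i => signVector W b (x i) j) ∈ halfspacePatterns x := by
  simp only [halfspacePatterns, signPatterns, mem_filter, mem_univ, true_and]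
  refine ⟨Fin.snoc (α := fun _ => ℝ) (fun i => W i j) (b j), fun i => ?_⟩
  rw [signVector_apply]
  simp [dotProduct, Fin.sum_univ_castSucc, mul_comm]

open Classical in
/-- The label patterns on `n` points of the functions of the sign vectors `fun j => S j i`. -/
def cellPatterns {n k : ℕ} (S : Fin k → Fin n → Label) : Finset (Fin n → Label) :=
  univ.image fun h : (univ.image fun i : Fin n => fun j => S j i : Finset (Fin k → Label)) → Label =>
    fun i => h ⟨fun j => S j i, mem_image_of_mem _ (mem_univ i)⟩

open Classical in
lemma exists_patterns_HAC {n d r k : ℕ} (x : Fin n → EuclideanSpace ℝ (Fin d)) :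
    ∃ A : Finset (Fin n → Label), (∀ f ∈ HAC d r k, (fun i => f (x i)) ∈ A) ∧
      A.card ≤ ((n + 1) ^ (d + 1)) ^ k * 2 ^ (k + 1) ^ d := by
  set T := (Fintype.piFinset fun _ : Fin k => halfspacePatterns x).filter
    fun S => (univ.image fun i : Fin n => fun j => S j i).card ≤ (k + 1) ^ d with hT
  refine ⟨T.biUnion cellPatterns, ?_, ?_⟩
  · rintro f ⟨h, W, b, -, rfl⟩
    refine mem_biUnion.mpr ⟨fun j i => signVector W b (x i) j, ?_, ?_⟩
    · refine mem_filter.mpr ⟨Fintype.mem_piFinset.mpr fun j => signVector_column_mem x W b j, ?_⟩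
      refine (card_le_card (t := signPatterns (fun j i => W i j) b) ?_).trans
        (by simpa using card_signPatterns_le (fun j i => W i j) b)
      intro p hp
      obtain ⟨i, -, rfl⟩ := mem_image.mp hp
      exact signVector_mem_signPatterns W b (x i)
    · exact mem_image.mpr ⟨fun v => h v.1, mem_univ _, rfl⟩
  · refine (card_biUnion_le_card_mul _ _ (2 ^ (k + 1) ^ d) fun S hS => ?_).trans ?_
    · refine card_image_le.trans ?_
      rw [card_univ, Fintype.card_fun, Fintype.card_coe]
      exact Nat.pow_le_pow_right (by norm_num) (mem_filter.mp hS).2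
    · refine Nat.mul_le_mul_right _ ((card_filter_le _ _).trans ?_)
      rw [Fintype.card_piFinset_const]
      exact Nat.pow_le_pow_left (card_halfspacePatterns_le x) k

end Patterns

section Rademacher

open Finset

/-- A label as a real number. -/
def labelReal (u : Label) : ℝ := ((u : ℤ) : ℝ)

@[simp] lemma labelReal_one : labelReal 1 = 1 := by simp [labelReal]

@[simp] lemma labelReal_neg (u : Label) : labelReal (-u) = -labelReal u := by simp [labelReal]

@[simp] lemma labelReal_mul (u v : Label) : labelReal (u * v) = labelReal u * labelReal v := by
  simp [labelReal]

lemma sum_label {M : Type*} [AddCommMonoid M] (g : Label → M) : ∑ s, g s = g 1 + g (-1) := by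
  rw [show (univ : Finset Label) = {1, -1} from rfl, sum_pair label_one_ne_neg_one]

lemma sum_signs_snoc {n : ℕ} (g : (Fin (n + 1) → Label) → ℝ) :
    ∑ σ, g σ = ∑ τ : Fin n → Label,
      (g (Fin.snoc (α := fun _ => Label) τ 1) + g (Fin.snoc (α := fun _ => Label) τ (-1))) := by
  rw [← (Fin.snocEquiv fun _ : Fin (n + 1) => Label).sum_comp, Fintype.sum_prod_type_right]
  exact sum_congr rfl fun τ _ => sum_label _

lemma card_signs (n : ℕ) : Fintype.card (Fin n → Label) = 2 ^ n := by
  simp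

/-- `B` bounds the (unnormalized) Rademacher complexity of the class `F` on samples of size `n`:
for every sample, the mean over the signs `σ` of the correlation of `σ` with any member of `F`
chosen depending on `σ` is at most `B`. -/
def RademacherBound {X : Type*} (F : Set (X → Label)) (n : ℕ) (B : ℝ) : Prop :=
  ∀ (x : Fin n → X) (c : (Fin n → Label) → X → Label), (∀ σ, c σ ∈ F) →
    ∑ σ, ∑ i, labelReal (σ i) * labelReal (c σ (x i)) ≤ 2 ^ n * B

lemma RademacherBound.mono {X : Type*} {F : Set (X → Label)} {n : ℕ} {B B' : ℝ}
    (h : RademacherBound F n B) (hB : B ≤ B') : RademacherBound F n B' := fun x c hc =>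
  (h x c hc).trans (by gcongr)

section Massart

lemma sum_exp_correlation {n : ℕ} (l : ℝ) (v : Fin n → Label) :
    ∑ σ : Fin n → Label, Real.exp (l * ∑ i, labelReal (σ i) * labelReal (v i))
      = (2 * Real.cosh l) ^ n := by
  have h1 : ∀ σ : Fin n → Label, Real.exp (l * ∑ i, labelReal (σ i) * labelReal (v i))
      = ∏ i, Real.exp (l * (labelReal (σ i) * labelReal (v i))) := by
    intro σ
    rw [mul_sum, Real.exp_sum]
  have h2 := (prod_univ_sum (fun _ : Fin n => (univ : Finset Label))
    fun i s => Real.exp (l * (labelReal s * labelReal (v i)))).symm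
  rw [Fintype.piFinset_univ] at h2
  rw [sum_congr rfl fun σ _ => h1 σ, h2]
  rw [prod_congr rfl (g := fun _ => 2 * Real.cosh l), prod_const, card_univ, Fintype.card_fin]
  intro i _
  rw [sum_label, Real.cosh_eq]
  rcases Int.units_eq_one_or (v i) with h | h <;> simp [h] <;> ring

/-- The maximal correlation with `|A|` sign patterns is on average at most `log |A| / l + n l / 2`. -/
lemma sum_correlation_le {n : ℕ} (A : Finset (Fin n → Label)) {l : ℝ} (hl : 0 < l)
    (c : (Fin n → Label) → Fin n → Label) (hc : ∀ σ, c σ ∈ A) :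
    ∑ σ, ∑ i, labelReal (σ i) * labelReal (c σ i)
      ≤ 2 ^ n * (Real.log A.card / l + n * l / 2) := by
  set S : (Fin n → Label) → (Fin n → Label) → ℝ :=
    fun σ v => ∑ i, labelReal (σ i) * labelReal (v i) with hS
  have hA : (0 : ℝ) < A.card := by
    exact_mod_cast card_pos.mpr ⟨_, hc 1⟩
  set a := Real.log A.card + n * l ^ 2 / 2 with ha
  have hexp : ∑ σ, Real.exp (l * S σ (c σ)) ≤ 2 ^ n * Real.exp a := by
    calc ∑ σ, Real.exp (l * S σ (c σ)) ≤ ∑ σ, ∑ v ∈ A, Real.exp (l * S σ v) :=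
          sum_le_sum fun σ _ => single_le_sum (f := fun v => Real.exp (l * S σ v))
            (fun v _ => (Real.exp_pos _).le) (hc σ)
      _ = A.card * (2 * Real.cosh l) ^ n := by
          rw [sum_comm, sum_congr rfl fun v _ => sum_exp_correlation l v, sum_const, nsmul_eq_mul]
      _ ≤ A.card * (2 * Real.exp (l ^ 2 / 2)) ^ n := by
          have := Real.cosh_le_exp_half_sq l
          have := Real.cosh_pos l
          gcongr
      _ = 2 ^ n * Real.exp a := by
          rw [ha, Real.exp_add, Real.exp_log hA, mul_pow, ← Real.exp_nat_mul, mul_div_assoc]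
          ring
  have hlin : ∑ σ, l * S σ (c σ) ≤ 2 ^ n * a := by
    have hpt : ∀ σ, l * S σ (c σ) ≤ Real.exp (l * S σ (c σ)) * Real.exp (-a) + (a - 1) := by
      intro σ
      rw [← Real.exp_add]
      have := Real.add_one_le_exp (l * S σ (c σ) + -a)
      linarith
    calc ∑ σ, l * S σ (c σ)
        ≤ ∑ σ, (Real.exp (l * S σ (c σ)) * Real.exp (-a) + (a - 1)) := sum_le_sum fun σ _ => hpt σ
      _ = (∑ σ, Real.exp (l * S σ (c σ))) * Real.exp (-a) + 2 ^ n * (a - 1) := by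
          rw [sum_add_distrib, sum_mul, sum_const, card_univ, card_signs, nsmul_eq_mul]
          push_cast; ring
      _ ≤ 2 ^ n * Real.exp a * Real.exp (-a) + 2 ^ n * (a - 1) := by gcongr
      _ = 2 ^ n * a := by
          rw [mul_assoc, ← Real.exp_add, add_neg_cancel, Real.exp_zero]; ring
  rw [← mul_sum] at hlin
  have : 2 ^ n * (Real.log A.card / l + n * l / 2) = 2 ^ n * a / l := by
    rw [ha]; field_simp
  rw [this, le_div_iff₀ hl]
  linarith

end Massart

section RandomWalk

/-- Values of the best label sequences ending in `1` and in `-1`, when one more sign `s` is revealed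
and every change of label costs `l`. -/
def bestStep (l : ℝ) (D : ℝ × ℝ) (s : ℝ) : ℝ × ℝ :=
  (max (D.1 + s) (D.2 - s - l), max (D.2 - s) (D.1 + s - l))

/-- The largest values of (correlation with `σ`) `- l *` (number of label changes) over the label
sequences that end in `1` and in `-1`. -/
def bestValue (l : ℝ) : ∀ n : ℕ, (Fin n → Label) → ℝ × ℝ
  | 0, _ => (0, 0)
  | n + 1, σ => bestStep l (bestValue l n fun i => σ i.castSucc) (labelReal (σ (Fin.last n)))

/-- A potential that controls the expected growth of `bestValue`. -/
def potential (l : ℝ) (D : ℝ × ℝ) : ℝ := (D.1 + D.2) / 2 + (D.1 - D.2) ^ 2 / (4 * l)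

lemma potential_max_le {l : ℝ} (hl : 0 < l) (a b : ℝ) :
    potential l (max a (b - l), max b (a - l)) ≤ potential l (a, b) := by
  simp only [potential]
  rcases le_total a (b - l) with h | h
  · rw [max_eq_right h, max_eq_left (by linarith), ← sub_nonneg]
    have : (a + b) / 2 + (a - b) ^ 2 / (4 * l) - ((b - l + b) / 2 + (b - l - b) ^ 2 / (4 * l))
        = (b - l - a) ^ 2 / (4 * l) := by field_simp; ring
    rw [this]; positivity
  · rw [max_eq_left h]
    rcases le_total b (a - l) with h' | h'
    · rw [max_eq_right h', ← sub_nonneg]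
      have : (a + b) / 2 + (a - b) ^ 2 / (4 * l) - ((a + (a - l)) / 2 + (a - (a - l)) ^ 2 / (4 * l))
          = (a - l - b) ^ 2 / (4 * l) := by field_simp; ring
      rw [this]; positivity
    · rw [max_eq_left h']

lemma potential_bestStep_le {l : ℝ} (hl : 0 < l) (D : ℝ × ℝ) :
    potential l (bestStep l D 1) + potential l (bestStep l D (-1)) ≤ 2 * potential l D + 2 / l := by
  have h1 := potential_max_le hl (D.1 + 1) (D.2 - 1)
  have h2 := potential_max_le hl (D.1 + -1) (D.2 - -1)
  have : potential l (D.1 + 1, D.2 - 1) + potential l (D.1 + -1, D.2 - -1)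
      = 2 * potential l D + 2 / l := by
    simp only [potential]; field_simp; ring
  unfold bestStep
  linarith

lemma sum_potential_bestValue_le {l : ℝ} (hl : 0 < l) (n : ℕ) :
    ∑ σ : Fin n → Label, potential l (bestValue l n σ) ≤ 2 ^ n * (n / l) := by
  induction n with
  | zero => simp [bestValue, potential]
  | succ n ih =>
    rw [sum_signs_snoc]
    calc _ ≤ ∑ τ : Fin n → Label, (2 * potential l (bestValue l n τ) + 2 / l) := by
          refine sum_le_sum fun τ _ => ?_
          simpa [bestValue] using potential_bestStep_le hl (bestValue l n τ)
      _ = 2 * ∑ τ : Fin n → Label, potential l (bestValue l n τ) + 2 ^ n * (2 / l) := by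
          rw [sum_add_distrib, mul_sum, sum_const, card_univ, card_signs, nsmul_eq_mul]
          push_cast; ring
      _ ≤ 2 * (2 ^ n * (n / l)) + 2 ^ n * (2 / l) := by gcongr
      _ = _ := by push_cast; field_simp; ring

/-- The number of label changes of `v` among the first `n` steps. -/
def changes (v : ℕ → Label) (n : ℕ) : ℕ := ((range n).filter fun i => v i ≠ v (i + 1)).card

lemma correlation_sub_changes_le (l : ℝ) (n : ℕ) (σ : Fin n → Label) (v : ℕ → Label) :
    (∑ i, labelReal (σ i) * labelReal (v i)) - l * changes v n
      ≤ if v n = 1 then (bestValue l n σ).1 else (bestValue l n σ).2 := by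
  induction n with
  | zero => simp [bestValue, changes]
  | succ n ih =>
    have hch : (changes v (n + 1) : ℝ) = changes v n + if v n ≠ v (n + 1) then 1 else 0 := by
      unfold changes
      rw [range_add_one, filter_insert]
      split_ifs with h
      · rw [card_insert_of_notMem (by simp)]; push_cast; ring
      · simp
    have := ih fun i => σ i.castSucc
    rw [Fin.sum_univ_castSucc, hch]
    simp only [Fin.val_castSucc, Fin.val_last, bestValue, bestStep]
    set s := labelReal (σ (Fin.last n))
    set D := bestValue l n fun i => σ i.castSucc
    rcases Int.units_eq_one_or (v n) with h | h <;>
      rcases Int.units_eq_one_or (v (n + 1)) with h' | h' <;>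
      simp only [h, h', label_one_ne_neg_one, label_one_ne_neg_one.symm, ne_eq, not_true_eq_false,
        not_false_eq_true, if_true, if_false, labelReal_one, labelReal_neg] at this ⊢
    · exact le_max_of_le_left (by linarith)
    · exact le_max_of_le_right (by linarith)
    · exact le_max_of_le_right (by linarith)
    · exact le_max_of_le_left (by linarith)

lemma ite_le_potential {l : ℝ} (hl : 0 < l) (D : ℝ × ℝ) (p : Prop) [Decidable p] :
    (if p then D.1 else D.2) ≤ potential l D + l / 4 := by
  unfold potential
  rw [← sub_nonneg]
  split_ifs
  · have : (D.1 + D.2) / 2 + (D.1 - D.2) ^ 2 / (4 * l) + l / 4 - D.1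
        = (D.1 - D.2 - l) ^ 2 / (4 * l) := by field_simp; ring
    rw [this]; positivity
  · have : (D.1 + D.2) / 2 + (D.1 - D.2) ^ 2 / (4 * l) + l / 4 - D.2
        = (D.1 - D.2 + l) ^ 2 / (4 * l) := by field_simp; ring
    rw [this]; positivity

/-- Label sequences with at most `k` changes correlate with random signs by at most
`n / l + l / 4 + l k` on average. -/
lemma sum_correlation_le_of_changes {n k : ℕ} {l : ℝ} (hl : 0 < l)
    (v : (Fin n → Label) → ℕ → Label) (hv : ∀ σ, changes (v σ) n ≤ k) :
    ∑ σ, ∑ i : Fin n, labelReal (σ i) * labelReal (v σ i) ≤ 2 ^ n * (n / l + l / 4 + l * k) := by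
  calc _ ≤ ∑ σ : Fin n → Label, (potential l (bestValue l n σ) + (l / 4 + l * k)) := by
        refine sum_le_sum fun σ _ => ?_
        have h1 := correlation_sub_changes_le l n σ (v σ)
        have h2 := ite_le_potential hl (bestValue l n σ) (v σ n = 1)
        have h3 : l * changes (v σ) n ≤ l * k := by
          have : (changes (v σ) n : ℝ) ≤ k := by exact_mod_cast hv σ
          gcongr
        linarith
    _ = ∑ σ : Fin n → Label, potential l (bestValue l n σ) + 2 ^ n * (l / 4 + l * k) := by
        rw [sum_add_distrib, sum_const, card_univ, card_signs, nsmul_eq_mul]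
        push_cast; ring
    _ ≤ 2 ^ n * (n / l) + 2 ^ n * (l / 4 + l * k) := by
        gcongr; exact sum_potential_bestValue_le hl n
    _ = _ := by ring

end RandomWalk

section Line

lemma changes_sgn_le_one (w b : ℝ) {y : ℕ → ℝ} (hy : Monotone y) (n : ℕ) :
    changes (fun i => sgn (w * y i + b)) n ≤ 1 := by
  have key : ∀ i j, i < j → sgn (w * y i + b) ≠ sgn (w * y (i + 1) + b) →
      sgn (w * y j + b) ≠ sgn (w * y (j + 1) + b) → False := by
    intro i j hij hi hj
    have h1 := hy (Nat.le_succ i)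
    have h2 := hy (Nat.succ_le_of_lt hij)
    have h3 := hy (Nat.le_succ j)
    unfold sgn at hi hj
    simp only [Nat.succ_eq_add_one] at h1 h2 h3
    rcases le_total 0 w with hw | hw
    · have := mul_le_mul_of_nonneg_left h1 hw
      have := mul_le_mul_of_nonneg_left h2 hw
      have := mul_le_mul_of_nonneg_left h3 hw
      split_ifs at hi hj <;> first | exact hi rfl | exact hj rfl | linarith
    · have := mul_le_mul_of_nonpos_left h1 hw
      have := mul_le_mul_of_nonpos_left h2 hw
      have := mul_le_mul_of_nonpos_left h3 hw
      split_ifs at hi hj <;> first | exact hi rfl | exact hj rfl | linarith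
  unfold changes
  rw [card_le_one]
  intro i hi j hj
  simp only [mem_filter] at hi hj
  rcases lt_trichotomy i j with h | h | h
  · exact (key i j h hi.2 hj.2).elim
  · exact h
  · exact (key j i h hj.2 hi.2).elim

lemma changes_comp_le {k : ℕ} (h : (Fin k → Label) → Label) (u : ℕ → Fin k → Label) (n : ℕ)
    (hu : ∀ j, changes (fun i => u i j) n ≤ 1) : changes (fun i => h (u i)) n ≤ k := by
  have hsub : (range n).filter (fun i => h (u i) ≠ h (u (i + 1))) ⊆
      univ.biUnion fun j => (range n).filter fun i => u i j ≠ u (i + 1) j := by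
    intro i hi
    rw [mem_filter] at hi
    have : ∃ j, u i j ≠ u (i + 1) j := by
      by_contra! hne
      exact hi.2 (congrArg h (funext hne))
    obtain ⟨j, hj⟩ := this
    exact mem_biUnion.mpr ⟨j, mem_univ _, mem_filter.mpr ⟨hi.1, hj⟩⟩
  refine (card_le_card hsub).trans ((card_biUnion_le_card_mul _ _ 1 fun j _ => hu j).trans ?_)
  simp

/-- On the line, arrangement classifiers have Rademacher complexity `O(√(n k))`. -/
lemma rademacherBound_line {n r k : ℕ} (hn : 1 ≤ n) {l : ℝ} (hl : 0 < l) :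
    RademacherBound (HAC 1 r k) n (n / l + l / 4 + l * k) := by
  intro x c hc
  set π := Tuple.sort fun i => x i 0 with hπ
  have hmono : Monotone fun i => x (π i) 0 := Tuple.monotone_sort fun i => x i 0
  set e : ℕ → Fin n := fun i => ⟨min i (n - 1), by omega⟩ with he
  have hemono : Monotone e := fun i j hij => by
    simp only [he, Fin.mk_le_mk]; omega
  have hei : ∀ i : Fin n, e i = i := fun i => by
    ext; simp only [he]; omega
  set v : (Fin n → Label) → ℕ → Label := fun σ i => c (σ ∘ π.symm) (x (π (e i))) with hv
  have hch : ∀ σ, changes (v σ) n ≤ k := by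
    intro σ
    obtain ⟨h, W, b, -, hf⟩ := hc (σ ∘ π.symm)
    simp only [hv, hf]
    refine changes_comp_le h (fun i => signVector W b (x (π (e i)))) n fun j => ?_
    simp only [signVector_apply, Fin.sum_univ_one]
    exact changes_sgn_le_one (W 0 j) (b j) (hmono.comp hemono) n
  refine le_trans (le_of_eq ?_) (sum_correlation_le_of_changes hl v hch)
  refine (Fintype.sum_equiv (Equiv.arrowCongr π (Equiv.refl Label)) _ _ fun σ => ?_).symm
  refine Fintype.sum_equiv π _ _ fun i => ?_
  simp [hv, hei, Equiv.arrowCongr, Function.comp_def]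

end Line

/-- The Rademacher complexity of arrangement classifiers from the number of their patterns. -/
lemma rademacherBound_HAC {n d r k : ℕ} {l : ℝ} (hl : 0 < l) :
    RademacherBound (HAC d r k) n
      ((k * (d + 1) * Real.log (n + 1) + (k + 1) ^ d) / l + n * l / 2) := by
  intro x c hc
  obtain ⟨A, hA, hcard⟩ := exists_patterns_HAC (r := r) (k := k) x
  refine (sum_correlation_le A hl (fun σ i => c σ (x i)) fun σ => hA _ (hc σ)).trans ?_
  have hpos : (0 : ℝ) < A.card := by exact_mod_cast card_pos.mpr ⟨_, hA _ (hc 1)⟩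
  have hlog : Real.log A.card ≤ k * (d + 1) * Real.log (n + 1) + (k + 1) ^ d := by
    have h1 : (A.card : ℝ) ≤ (((n : ℝ) + 1) ^ (d + 1)) ^ k * 2 ^ (k + 1) ^ d := by
      exact_mod_cast hcard
    refine (Real.log_le_log hpos h1).trans ?_
    rw [Real.log_mul (by positivity) (by positivity), Real.log_pow, Real.log_pow, Real.log_pow]
    have h2 : Real.log 2 ≤ 1 := by
      have := Real.log_le_sub_one_of_pos (show (0 : ℝ) < 2 by norm_num)
      linarith
    have h3 : (0 : ℝ) ≤ ((k : ℝ) + 1) ^ d := by positivity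
    push_cast
    nlinarith
  gcongr

end Rademacher

section Symmetrization

variable {X : Type}

/-- The zero-one loss. -/
def loss (f : X → Label) (z : X × Label) : ℝ := if f z.1 ≠ z.2 then 1 else 0

lemma loss_nonneg (f : X → Label) (z : X × Label) : 0 ≤ loss f z := by
  unfold loss; split_ifs <;> norm_num

lemma loss_le_one (f : X → Label) (z : X × Label) : loss f z ≤ 1 := by
  unfold loss; split_ifs <;> norm_num

lemma loss_eq (f : X → Label) (z : X × Label) :
    loss f z = (1 - labelReal (f z.1) * labelReal z.2) / 2 := by
  unfold loss
  rcases Int.units_eq_one_or (f z.1) with h | h <;> rcases Int.units_eq_one_or z.2 with h' | h' <;>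
    simp [h, h', label_one_ne_neg_one.symm]

lemma labelReal_mul_self (u : Label) : labelReal u * labelReal u = 1 := by
  rw [← labelReal_mul, Int.units_mul_self, labelReal_one]

lemma sum_signs_eq_zero {n : ℕ} (a : Fin n → ℝ) :
    ∑ σ : Fin n → Label, ∑ j, a j * labelReal (σ j) = 0 := by
  have h := Equiv.sum_comp (Equiv.neg (Fin n → Label)) fun σ => ∑ j, a j * labelReal (σ j)
  simp only [Equiv.neg_apply, Pi.neg_apply, labelReal_neg, mul_neg, Finset.sum_neg_distrib] at h
  linarith

lemma sum_loss_le {F : Set (X → Label)} {n : ℕ} {B : ℝ} (hF : RademacherBound F n B) (ε : Label)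
    (z : Fin n → X × Label) (c : (Fin n → Label) → X → Label) (hc : ∀ σ, c σ ∈ F) :
    ∑ σ, ∑ j, labelReal ε * labelReal (σ j) * loss (c σ) (z j) ≤ 2 ^ n * (B / 2) := by
  set u : Fin n → Label := fun j => -ε * (z j).2 with hu
  rw [← Equiv.sum_comp (Equiv.mulLeft u)
    fun σ => ∑ j, labelReal ε * labelReal (σ j) * loss (c σ) (z j)]
  have h := hF (fun j => (z j).1) (fun σ => c (u * σ)) fun σ => hc _
  have h0 := sum_signs_eq_zero fun j => labelReal (z j).2
  have heq : ∑ σ : Fin n → Label, ∑ j, labelReal ε * labelReal (Equiv.mulLeft u σ j) *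
      loss (c (Equiv.mulLeft u σ)) (z j)
      = (∑ σ : Fin n → Label, ∑ j, labelReal (σ j) * labelReal (c (u * σ) (z j).1)) / 2
        - (∑ σ : Fin n → Label, ∑ j, labelReal (z j).2 * labelReal (σ j)) / 2 := by
    rw [Finset.sum_div, Finset.sum_div, ← Finset.sum_sub_distrib]
    refine Finset.sum_congr rfl fun σ _ => ?_
    rw [Finset.sum_div, Finset.sum_div, ← Finset.sum_sub_distrib]
    refine Finset.sum_congr rfl fun j _ => ?_
    have h1 := labelReal_mul_self ε
    have h2 := labelReal_mul_self (z j).2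
    simp only [Equiv.coe_mulLeft, loss_eq, Pi.mul_apply, hu, labelReal_mul, labelReal_neg]
    set y := labelReal (z j).2
    set e := labelReal ε
    set s := labelReal (σ j)
    set f := labelReal (c _ _)
    linear_combination (-(y * s) / 2 + s * f * y * y / 2) * h1 + s * f / 2 * h2
  rw [heq, h0]
  linarith

lemma abs_ciSup_le {ι : Type*} [Nonempty ι] {f : ι → ℝ} {C : ℝ} (h : ∀ i, |f i| ≤ C) :
    |⨆ i, f i| ≤ C := by
  have hb : BddAbove (Set.range f) := ⟨C, by rintro _ ⟨i, rfl⟩; exact (abs_le.mp (h i)).2⟩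
  obtain ⟨i⟩ := ‹Nonempty ι›
  exact abs_le.mpr ⟨(abs_le.mp (h i)).1.trans (le_ciSup hb i), ciSup_le fun i => (abs_le.mp (h i)).2⟩

lemma bddAbove_of_abs_le {ι : Type*} {f : ι → ℝ} {C : ℝ} (h : ∀ i, |f i| ≤ C) :
    BddAbove (Set.range f) := ⟨C, by rintro _ ⟨i, rfl⟩; exact (abs_le.mp (h i)).2⟩

variable {ι : Type*} {g : ι → X → Label}

lemma sum_iSup_signed_le [Nonempty ι] {F : Set (X → Label)} {n : ℕ} {B : ℝ} (hF : RademacherBound F n B)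
    (hg : ∀ i, g i ∈ F) (z z' : Fin n → X × Label) :
    ∑ σ : Fin n → Label, ⨆ i, ∑ j, labelReal (σ j) * (loss (g i) (z' j) - loss (g i) (z j))
      ≤ 2 ^ n * B := by
  refine le_of_forall_pos_le_add fun ε hε => ?_
  have hch : ∀ σ : Fin n → Label, ∃ i, (⨆ i, ∑ j, labelReal (σ j) *
      (loss (g i) (z' j) - loss (g i) (z j))) - ε / 2 ^ n <
      ∑ j, labelReal (σ j) * (loss (g i) (z' j) - loss (g i) (z j)) := fun σ =>
    exists_lt_of_lt_ciSup (sub_lt_self _ (by positivity))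
  choose i hi using hch
  have h1 := sum_loss_le hF 1 z' (fun σ => g (i σ)) fun σ => hg _
  have h2 := sum_loss_le hF (-1) z (fun σ => g (i σ)) fun σ => hg _
  have h3 : ∑ σ : Fin n → Label, ((⨆ i, ∑ j, labelReal (σ j) *
      (loss (g i) (z' j) - loss (g i) (z j))) - ε / 2 ^ n) ≤
      ∑ σ : Fin n → Label, ∑ j, labelReal 1 * labelReal (σ j) * loss (g (i σ)) (z' j) +
      ∑ σ : Fin n → Label, ∑ j, labelReal (-1) * labelReal (σ j) * loss (g (i σ)) (z j) := by
    rw [← Finset.sum_add_distrib]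
    refine Finset.sum_le_sum fun σ _ => (hi σ).le.trans (le_of_eq ?_)
    rw [← Finset.sum_add_distrib]
    refine Finset.sum_congr rfl fun j _ => ?_
    rw [labelReal_neg, labelReal_one]; ring
  rw [Finset.sum_sub_distrib, Finset.sum_const, Finset.card_univ, card_signs, nsmul_eq_mul] at h3
  have h4 : ((2 ^ n : ℕ) : ℝ) * (ε / 2 ^ n) = ε := by push_cast; field_simp
  linarith

/-- The largest difference of the losses on a ghost sample and on a sample. -/
def ghostSup (g : ι → X → Label) {n : ℕ} (q : Fin n → (X × Label) × (X × Label)) : ℝ :=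
  ⨆ i, ∑ j, (loss (g i) (q j).2 - loss (g i) (q j).1)

lemma abs_sum_loss_sub_le {n : ℕ} (q : Fin n → (X × Label) × (X × Label)) (i : ι) :
    |∑ j, (loss (g i) (q j).2 - loss (g i) (q j).1)| ≤ n := by
  refine (Finset.abs_sum_le_sum_abs _ _).trans ?_
  refine (Finset.sum_le_card_nsmul _ _ 1 fun j _ => ?_).trans (by simp)
  have h1 := loss_nonneg (g i) (q j).1
  have h2 := loss_nonneg (g i) (q j).2
  have h3 := loss_le_one (g i) (q j).1
  have h4 := loss_le_one (g i) (q j).2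
  exact abs_le.mpr ⟨by linarith, by linarith⟩

lemma tendsto_loss {f : X → Label} {u : ℕ → ι} (hu : ∀ x, ∀ᶠ m in Filter.atTop, g (u m) x = f x)
    (z : X × Label) :
    Filter.Tendsto (fun m => loss (g (u m)) z) Filter.atTop (nhds (loss f z)) := by
  refine tendsto_const_nhds.congr' ?_
  filter_upwards [hu z.1] with m hm
  simp [loss, hm]

variable [MeasurableSpace X]

lemma measurableSet_error {f : X → Label} (hf : Measurable f) :
    MeasurableSet {z : X × Label | f z.1 ≠ z.2} :=
  ((hf.comp measurable_fst).prodMk measurable_snd)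
    (MeasurableSet.of_discrete (s := {p : Label × Label | p.1 ≠ p.2}))

lemma measurable_loss {f : X → Label} (hf : Measurable f) : Measurable (loss f) :=
  Measurable.ite (measurableSet_error hf) measurable_const measurable_const

lemma risk_eq_integral (P : Measure (X × Label)) {f : X → Label} (hf : Measurable f) :
    risk P f = ∫ z, loss f z ∂P := by
  have : loss f = Set.indicator {z : X × Label | f z.1 ≠ z.2} 1 := by
    ext z; simp [loss, Set.indicator_apply]
  rw [this, integral_indicator_one (measurableSet_error hf), risk]

lemma integrable_loss (P : Measure (X × Label)) [IsFiniteMeasure P] {f : X → Label}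
    (hf : Measurable f) : Integrable (loss f) P :=
  Integrable.of_bound (measurable_loss hf).aestronglyMeasurable 1 (ae_of_all _ fun z => by
    rw [Real.norm_of_nonneg (loss_nonneg f z)]; exact loss_le_one f z)

lemma measurable_of_eventually_eq {f : X → Label} {u : ℕ → ι} (hg : ∀ i, Measurable (g i))
    (hu : ∀ x, ∀ᶠ m in Filter.atTop, g (u m) x = f x) : Measurable f := by
  refine measurable_to_countable' fun y => ?_
  have : f ⁻¹' {y} = ⋃ M : ℕ, ⋂ m : ℕ, ⋂ _ : M ≤ m, g (u m) ⁻¹' {y} := by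
    ext x
    simp only [Set.mem_preimage, Set.mem_singleton_iff, Set.mem_iUnion, Set.mem_iInter]
    obtain ⟨M, hM⟩ := Filter.eventually_atTop.mp (hu x)
    refine ⟨fun h => ⟨M, fun m hm => (hM m hm).trans h⟩, fun ⟨N, hN⟩ => ?_⟩
    rw [← hM (max M N) (le_max_left _ _)]
    exact hN _ (le_max_right _ _)
  rw [this]
  exact MeasurableSet.iUnion fun M => MeasurableSet.iInter fun m => MeasurableSet.iInter fun _ =>
    hg _ (measurableSet_singleton y)

variable (P : Measure (X × Label)) [IsProbabilityMeasure P]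

lemma integrable_sum_loss {f : X → Label} (hf : Measurable f) (n : ℕ) :
    Integrable (fun s : Fin n → X × Label => ∑ j, loss f (s j)) (Measure.pi fun _ => P) :=
  integrable_finsetSum _ fun j _ =>
    (measurePreserving_eval (fun _ : Fin n => P) j).integrable_comp_of_integrable
      (integrable_loss P hf)

lemma integral_sum_loss {f : X → Label} (hf : Measurable f) (n : ℕ) :
    ∫ s : Fin n → X × Label, ∑ j, loss f (s j) ∂(Measure.pi fun _ => P) = n * risk P f := by
  have hj : ∀ j : Fin n, ∫ s : Fin n → X × Label, loss f (s j) ∂(Measure.pi fun _ => P)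
      = risk P f := fun j => by
    have h := measurePreserving_eval (fun _ : Fin n => P) j
    rw [risk_eq_integral P hf]
    conv_rhs => rw [← h.map_eq]
    rw [integral_map h.measurable.aemeasurable (measurable_loss hf).aestronglyMeasurable]
  rw [integral_finsetSum]
  · simp [hj]
  · exact fun j _ => (measurePreserving_eval (fun _ : Fin n => P) j).integrable_comp_of_integrable
      (integrable_loss P hf)

lemma measurable_ghostSup [Countable ι] (hg : ∀ i, Measurable (g i)) (n : ℕ) :
    Measurable (ghostSup g (n := n)) :=
  Measurable.iSup fun i => Finset.measurable_sum _ fun j _ =>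
    ((measurable_loss (hg i)).comp (measurable_snd.comp (measurable_pi_apply j))).sub
      ((measurable_loss (hg i)).comp (measurable_fst.comp (measurable_pi_apply j)))

lemma integrable_ghostSup [Nonempty ι] [Countable ι] (hg : ∀ i, Measurable (g i)) (n : ℕ)
    (μ : Measure (Fin n → (X × Label) × (X × Label))) [IsFiniteMeasure μ] :
    Integrable (ghostSup g (n := n)) μ :=
  Integrable.of_bound (measurable_ghostSup hg n).aestronglyMeasurable n (ae_of_all _ fun q =>
    abs_ciSup_le fun i => abs_sum_loss_sub_le q i)

lemma integral_ghostSup_le [Nonempty ι] [Countable ι] {F : Set (X → Label)} {n : ℕ} {B : ℝ} (hF : RademacherBound F n B)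
    (hgF : ∀ i, g i ∈ F) (hg : ∀ i, Measurable (g i)) :
    ∫ q, ghostSup g q ∂(Measure.pi fun _ : Fin n => P.prod P) ≤ B := by
  set Q := Measure.pi fun _ : Fin n => P.prod P with hQ
  set T : (Fin n → Label) → (Fin n → (X × Label) × (X × Label)) → Fin n → (X × Label) × (X × Label) :=
    fun σ q j => (if σ j = 1 then id else Prod.swap) (q j) with hTdef
  have hT : ∀ σ, MeasurePreserving (T σ) Q Q := fun σ =>
    measurePreserving_pi _ _ fun j => by
      split_ifs
      · exact MeasurePreserving.id _
      · exact Measure.measurePreserving_swap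
  have hTsup : ∀ σ q, ghostSup g (T σ q) =
      ⨆ i, ∑ j, labelReal (σ j) * (loss (g i) (q j).2 - loss (g i) (q j).1) := by
    intro σ q
    unfold ghostSup
    congr 1; funext i
    refine Finset.sum_congr rfl fun j _ => ?_
    rcases Int.units_eq_one_or (σ j) with h | h <;>
      simp [hTdef, h, label_one_ne_neg_one.symm]
  have hint : ∀ σ, ∫ q, ghostSup g (T σ q) ∂Q = ∫ q, ghostSup g q ∂Q := fun σ => by
    conv_rhs => rw [← (hT σ).map_eq]
    rw [integral_map (hT σ).measurable.aemeasurable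
      (measurable_ghostSup hg n).aestronglyMeasurable]
  have hintegrable : ∀ σ, Integrable (fun q => ghostSup g (T σ q)) Q := fun σ =>
    (hT σ).integrable_comp_of_integrable (integrable_ghostSup hg n Q)
  have h1 : ∑ σ : Fin n → Label, ∫ q, ghostSup g (T σ q) ∂Q ≤ 2 ^ n * B := by
    rw [← integral_finsetSum _ fun σ _ => hintegrable σ]
    have : ∫ _ : Fin n → (X × Label) × (X × Label), (2 ^ n * B : ℝ) ∂Q = 2 ^ n * B := by simp
    rw [← this]
    refine integral_mono (integrable_finsetSum _ fun σ _ => hintegrable σ) (integrable_const _)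
      fun q => ?_
    simp only [hTsup]
    exact sum_iSup_signed_le hF hgF (fun j => (q j).1) fun j => (q j).2
  simp only [hint, Finset.sum_const, Finset.card_univ, card_signs, nsmul_eq_mul] at h1
  push_cast at h1
  exact le_of_mul_le_mul_left h1 (by positivity)

/-- The largest gap between risk and empirical risk in the family `g`, multiplied by `n`. -/
def gapSup (g : ι → X → Label) {n : ℕ} (s : Fin n → X × Label) : ℝ :=
  ⨆ i, (n * risk P (g i) - ∑ j, loss (g i) (s j))

lemma abs_gap_le {n : ℕ} (s : Fin n → X × Label) (i : ι) :
    |n * risk P (g i) - ∑ j, loss (g i) (s j)| ≤ n := by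
  have h1 : 0 ≤ risk P (g i) := measureReal_nonneg
  have h2 : risk P (g i) ≤ 1 := measureReal_le_one
  have h3 : 0 ≤ ∑ j, loss (g i) (s j) := Finset.sum_nonneg fun j _ => loss_nonneg _ _
  have h4 : ∑ j, loss (g i) (s j) ≤ n :=
    (Finset.sum_le_card_nsmul _ _ 1 fun j _ => loss_le_one _ _).trans (by simp)
  have hn : (0 : ℝ) ≤ n := n.cast_nonneg
  exact abs_le.mpr ⟨by nlinarith, by nlinarith⟩

lemma integrable_gapSup [Nonempty ι] [Countable ι] (hg : ∀ i, Measurable (g i)) (n : ℕ) :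
    Integrable (gapSup P g (n := n)) (Measure.pi fun _ => P) :=
  Integrable.of_bound (Measurable.iSup fun i => measurable_const.sub
    (Finset.measurable_sum _ fun j _ =>
      (measurable_loss (hg i)).comp (measurable_pi_apply j))).aestronglyMeasurable n
    (ae_of_all _ fun s => abs_ciSup_le fun i => abs_gap_le P s i)

/-- The expected largest gap between risk and empirical risk is bounded by the Rademacher
complexity. -/
lemma integral_gapSup_le [Nonempty ι] [Countable ι] {F : Set (X → Label)} {n : ℕ} {B : ℝ} (hF : RademacherBound F n B)
    (hgF : ∀ i, g i ∈ F) (hg : ∀ i, Measurable (g i)) :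
    ∫ s, gapSup P g s ∂(Measure.pi fun _ : Fin n => P) ≤ B := by
  set μ := Measure.pi fun _ : Fin n => P with hμ
  set e := MeasurableEquiv.arrowProdEquivProdArrow (X × Label) (X × Label) (Fin n) with he
  have hpres : MeasurePreserving e (Measure.pi fun _ : Fin n => P.prod P) (μ.prod μ) :=
    measurePreserving_arrowProdEquivProdArrow _ _ _ (fun _ => P) fun _ => P
  have hpres' := hpres.symm
  have hint : Integrable (fun p => ghostSup g (e.symm p)) (μ.prod μ) :=
    hpres'.integrable_comp_of_integrable (integrable_ghostSup hg n _)
  have h1 : ∫ p, ghostSup g (e.symm p) ∂(μ.prod μ) ≤ B := by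
    rw [hpres'.integral_comp' (ghostSup g)]
    exact integral_ghostSup_le P hF hgF hg
  rw [integral_prod _ hint] at h1
  refine le_trans (integral_mono_ae (integrable_gapSup P hg n) hint.integral_prod_left ?_) h1
  filter_upwards [hint.prod_right_ae] with s hs
  refine ciSup_le fun i => ?_
  have hpt : ∀ s', ∑ j, (loss (g i) (s' j) - loss (g i) (s j)) ≤ ghostSup g (e.symm (s, s')) :=
    fun s' => le_ciSup (bddAbove_of_abs_le fun i => abs_sum_loss_sub_le (g := g)
      (fun j => (s j, s' j)) i) i
  have hil := integrable_sum_loss P (hg i) n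
  calc n * risk P (g i) - ∑ j, loss (g i) (s j)
      = ∫ s', (∑ j, loss (g i) (s' j) - ∑ j, loss (g i) (s j)) ∂μ := by
        rw [integral_sub hil (integrable_const _), integral_sum_loss P (hg i) n]; simp
    _ ≤ _ := by
        refine integral_mono (hil.sub (integrable_const _)) hs fun s' => ?_
        simpa [Finset.sum_sub_distrib] using hpt s'

lemma gap_le_gapSup {f : X → Label} {u : ℕ → ι} (hg : ∀ i, Measurable (g i))
    (hu : ∀ x, ∀ᶠ m in Filter.atTop, g (u m) x = f x) {n : ℕ} (s : Fin n → X × Label) :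
    n * risk P f - ∑ j, loss f (s j) ≤ gapSup P g s := by
  have hrisk : Filter.Tendsto (fun m => risk P (g (u m))) Filter.atTop (nhds (risk P f)) := by
    simp only [risk_eq_integral P (hg _), risk_eq_integral P (measurable_of_eventually_eq hg hu)]
    refine tendsto_integral_of_dominated_convergence (fun _ => 1)
      (fun m => (measurable_loss (hg _)).aestronglyMeasurable) (integrable_const _)
      (fun m => ae_of_all _ fun z => ?_) (ae_of_all _ fun z => tendsto_loss hu z)
    rw [Real.norm_of_nonneg (loss_nonneg _ z)]
    exact loss_le_one _ z
  have hsum : Filter.Tendsto (fun m => ∑ j, loss (g (u m)) (s j)) Filter.atTop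
      (nhds (∑ j, loss f (s j))) := tendsto_finsetSum _ fun j _ => tendsto_loss hu (s j)
  refine le_of_tendsto' ((hrisk.const_mul (n : ℝ)).sub hsum) fun m => ?_
  exact le_ciSup (bddAbove_of_abs_le fun i => abs_gap_le P s i) (u m)

/-- Empirical risk minimization over a class with a countable pointwise dense subfamily. -/
theorem expectedRisk_le_of_isERM [Nonempty ι] [Countable ι] {C : Set (X → Label)} {n : ℕ} (hn : 1 ≤ n) {B : ℝ}
    (hC : RademacherBound C n B) (hgC : ∀ i, g i ∈ C) (hg : ∀ i, Measurable (g i))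
    (hdense : ∀ f ∈ C, ∃ u : ℕ → ι, ∀ x, ∀ᶠ m in Filter.atTop, g (u m) x = f x)
    {A : (Fin n → X × Label) → X → Label} (hA : IsERM C A)
    (hmeas : AEMeasurable (fun s => risk P (A s)) (Measure.pi fun _ => P))
    {f : X → Label} (hf : f ∈ C) : expectedRisk P A ≤ risk P f + B / n := by
  have hn0 : (0 : ℝ) < n := by exact_mod_cast hn
  obtain ⟨u, hu⟩ := hdense f hf
  have hfm := measurable_of_eventually_eq hg hu
  have hint : Integrable (fun s => risk P (A s)) (Measure.pi fun _ => P) :=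
    Integrable.of_bound hmeas.aestronglyMeasurable 1 (ae_of_all _ fun s => by
      unfold risk
      rw [Real.norm_of_nonneg measureReal_nonneg]; exact measureReal_le_one)
  have hpt : ∀ s, n * risk P (A s) ≤ ∑ j, loss f (s j) + gapSup P g s := by
    intro s
    obtain ⟨u, hu⟩ := hdense _ (hA s).1
    have h1 := gap_le_gapSup P hg hu s
    have h2 : ∑ j, loss (A s) (s j) ≤ ∑ j, loss f (s j) :=
      le_of_mul_le_mul_left ((hA s).2 f hf) (by positivity : (0 : ℝ) < 1 / n)
    linarith
  have h := integral_mono (hint.const_mul (n : ℝ))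
    ((integrable_sum_loss P hfm n).add (integrable_gapSup P hg n)) hpt
  rw [integral_const_mul] at h
  simp only [Pi.add_apply] at h
  rw [integral_add (integrable_sum_loss P hfm n) (integrable_gapSup P hg n),
    integral_sum_loss P hfm n] at h
  have hgap := integral_gapSup_le P hC hgC hg
  have : n * expectedRisk P A ≤ n * (risk P f + B / n) := by
    rw [mul_add, mul_div_cancel₀ _ hn0.ne']
    unfold expectedRisk
    linarith
  exact le_of_mul_le_mul_left this hn0

end Symmetrization

section RationalFamily

lemma measurable_sgn : Measurable sgn :=
  Measurable.ite measurableSet_Ici measurable_const measurable_const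

lemma measurable_comp_signVector {d k : ℕ} (h : (Fin k → Label) → Label)
    (W : Matrix (Fin d) (Fin k) ℝ) (b : Fin k → ℝ) :
    Measurable fun x : UnitCube d => h (signVector W b x.1) := by
  refine (measurable_of_finite h).comp (measurable_pi_lambda _ fun j => ?_)
  simp only [signVector_apply]
  refine measurable_sgn.comp (Continuous.measurable ?_)
  fun_prop

/-- The arrangement classifiers with rational parameters. -/
def rationalFamily (d k : ℕ)
    (p : ((Fin k → Label) → Label) × (Fin d → Fin k → ℚ) × (Fin k → ℚ)) : UnitCube d → Label :=
  fun x => p.1 (signVector (Matrix.of fun i j => (p.2.1 i j : ℝ)) (fun j => (p.2.2 j : ℝ)) x.1)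

lemma comp_signVector_mem_cubeHAC {d k : ℕ} (h : (Fin k → Label) → Label)
    (W : Matrix (Fin d) (Fin k) ℝ) (b : Fin k → ℝ) :
    (fun x : UnitCube d => h (signVector W b x.1)) ∈ cubeHAC d d k :=
  ⟨h ∘ signVector W b, ⟨h, W, b, Matrix.rank_le_height W, rfl⟩, fun _ => rfl⟩

lemma exists_rationalFamily_eventually_eq {d r k : ℕ} {f : UnitCube d → Label}
    (hf : f ∈ cubeHAC d r k) :
    ∃ u : ℕ → ((Fin k → Label) → Label) × (Fin d → Fin k → ℚ) × (Fin k → ℚ),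
      ∀ x, ∀ᶠ m in Filter.atTop, rationalFamily d k (u m) x = f x := by
  obtain ⟨_, ⟨h, W, b, -, rfl⟩, hfx⟩ := hf
  have happrox : ∀ t : ℝ, ∃ q : ℕ → ℚ, (∀ m, t ≤ q m) ∧
      Filter.Tendsto (fun m => (q m : ℝ)) Filter.atTop (nhds t) := by
    intro t
    have : ∀ m : ℕ, ∃ q : ℚ, t < q ∧ (q : ℝ) < t + 1 / ((m : ℝ) + 1) := fun m =>
      exists_rat_btwn (lt_add_of_pos_right t (by positivity))
    choose q hq using this
    refine ⟨q, fun m => (hq m).1.le, ?_⟩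
    refine tendsto_of_tendsto_of_tendsto_of_le_of_le tendsto_const_nhds ?_
      (fun m => (hq m).1.le) fun m => (hq m).2.le
    simpa using tendsto_const_nhds.add (tendsto_one_div_add_atTop_nhds_zero_nat (𝕜 := ℝ))
  choose qW hqW using fun i j => happrox (W i j)
  choose qb hqb using fun j => happrox (b j)
  refine ⟨fun m => (h, fun i j => qW i j m, fun j => qb j m), fun x => ?_⟩
  have hj : ∀ j, ∀ᶠ m in Filter.atTop,
      signVector (Matrix.of fun i j => (qW i j m : ℝ)) (fun j => (qb j m : ℝ)) x.1 j
        = signVector W b x.1 j := by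
    intro j
    simp only [signVector_apply, Matrix.of_apply]
    have hlim : Filter.Tendsto (fun m => (∑ i, (qW i j m : ℝ) * x.1 i) + qb j m) Filter.atTop
        (nhds ((∑ i, W i j * x.1 i) + b j)) :=
      (tendsto_finsetSum _ fun i _ => (hqW i j).2.mul_const _).add (hqb j).2
    rcases le_or_gt 0 ((∑ i, W i j * x.1 i) + b j) with h0 | h0
    · refine Filter.Eventually.of_forall fun m => ?_
      rw [sgn_of_nonneg h0, sgn_of_nonneg (h0.trans ?_)]
      exact add_le_add (Finset.sum_le_sum fun i _ =>
        mul_le_mul_of_nonneg_right ((hqW i j).1 m) (x.2 i).1) ((hqb j).1 m)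
    · filter_upwards [hlim.eventually_lt_const h0] with m hm
      rw [sgn_of_neg h0, sgn_of_neg hm]
  filter_upwards [Filter.eventually_all.mpr hj] with m hm
  rw [hfx, rationalFamily, funext hm]
  rfl

lemma RademacherBound.cubeHAC {d r k n : ℕ} {B : ℝ} (h : RademacherBound (HAC d r k) n B) :
    RademacherBound (cubeHAC d r k) n B := by
  intro x c hc
  choose c' hc' hcc' using hc
  simpa only [hcc'] using h (fun i => (x i).1) c' hc'

end RationalFamily

section Bayes

variable {X : Type} [MeasurableSpace X] {P : Measure (X × Label)} [IsProbabilityMeasure P]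
  {η : X → ℝ}

/-- The conditional risk of the label `y` at a point where the label `1` has probability `t`. -/
def condRisk (t : ℝ) (y : Label) : ℝ := if y = 1 then 1 - t else t

lemma condRisk_sgn_le (t : ℝ) (y : Label) : condRisk t (sgn (2 * t - 1)) ≤ condRisk t y := by
  unfold condRisk
  simp only [sgn_eq_one_iff]
  split_ifs <;> linarith

lemma condRisk_le_add (t t' : ℝ) (y : Label) : condRisk t y ≤ condRisk t' y + |t - t'| := by
  unfold condRisk
  have h1 := le_abs_self (t - t')
  have h2 := neg_abs_le (t - t')
  split_ifs <;> linarith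

lemma integrable_condRisk (hη : IsPosterior P η) {f : X → Label} (hf : Measurable f) :
    Integrable (fun x => condRisk (η x) (f x)) P.fst := by
  classical
  have heq : (fun x => condRisk (η x) (f x))
      = {x | f x = 1}.piecewise (fun x => 1 - η x) η := by
    funext x
    simp [condRisk, Set.piecewise]
  rw [heq]
  have hA : MeasurableSet {x | f x = 1} := hf (measurableSet_singleton 1)
  exact Integrable.piecewise hA ((integrable_const (1 : ℝ)).sub hη.1).integrableOn
    hη.1.integrableOn

lemma risk_eq_integral_condRisk (hη : IsPosterior P η) {f : X → Label} (hf : Measurable f) :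
    risk P f = ∫ x, condRisk (η x) (f x) ∂P.fst := by
  set A : Set X := {x | f x = 1} with hAdef
  have hA : MeasurableSet A := hf (measurableSet_singleton 1)
  have herr : {z : X × Label | f z.1 ≠ z.2} = A ×ˢ {-1} ∪ Aᶜ ×ˢ {1} := by
    ext ⟨x, y⟩
    rcases Int.units_eq_one_or (f x) with h | h <;> rcases Int.units_eq_one_or y with h' | h' <;>
      simp [hAdef, h, h', label_one_ne_neg_one.symm]
  have hdisj : Disjoint (A ×ˢ {(-1 : Label)}) (Aᶜ ×ˢ {(1 : Label)}) :=
    Set.disjoint_left.mpr fun z h1 h2 => h2.1 h1.1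
  have hfst : P.real (A ×ˢ {(1 : Label)}) + P.real (A ×ˢ {(-1 : Label)}) = P.fst.real A := by
    rw [← measureReal_union (Set.disjoint_left.mpr fun z h1 h2 =>
      label_one_ne_neg_one (h1.2.symm.trans h2.2)) (hA.prod (measurableSet_singleton _)),
      measureReal_def, measureReal_def, Measure.fst_apply hA]
    congr 2
    ext ⟨x, y⟩
    rcases Int.units_eq_one_or y with h' | h' <;> simp [h']
  rw [risk, herr, measureReal_union hdisj (hA.compl.prod (measurableSet_singleton _)),
    hη.2 _ hA.compl, ← integral_add_compl hA (integrable_condRisk hη hf)]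
  congr 1
  · rw [eq_sub_of_add_eq' hfst, hη.2 A hA,
      setIntegral_congr_fun hA (f := fun x => condRisk (η x) (f x)) (g := fun x => 1 - η x)
        fun x hx => if_pos hx,
      integral_sub (integrable_const _).integrableOn hη.1.integrableOn]
    simp
  · exact setIntegral_congr_fun hA.compl fun x hx => (if_neg hx).symm

/-- A classifier that follows the posterior at points where it differs by at most `ε` is within
`2 ε` of the Bayes risk. -/
lemma risk_le_bayesRisk_add (hη : IsPosterior P η) {f : X → Label} (hf : Measurable f) {ε : ℝ}
    (h : ∀ x, ∃ x', |η x - η x'| ≤ ε ∧ f x = sgn (2 * η x' - 1)) :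
    risk P f ≤ bayesRisk P + 2 * ε := by
  have : Nonempty {f : X → Label // Measurable f} := ⟨⟨f, hf⟩⟩
  rw [← sub_le_iff_le_add]
  refine le_ciInf fun ⟨g, hg⟩ => ?_
  rw [sub_le_iff_le_add, risk_eq_integral_condRisk hη hf, risk_eq_integral_condRisk hη hg]
  have hint := integrable_condRisk hη hg
  have heq : ∫ x, (condRisk (η x) (g x) + 2 * ε) ∂P.fst
      = ∫ x, condRisk (η x) (g x) ∂P.fst + 2 * ε := by
    rw [integral_add hint (integrable_const _)]; simp
  rw [← heq]
  refine integral_mono (integrable_condRisk hη hf) (hint.add (integrable_const _)) fun x => ?_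
  obtain ⟨x', hx', hfx⟩ := h x
  have h1 := condRisk_le_add (η x) (η x') (f x)
  have h2 := condRisk_sgn_le (η x') (g x)
  have h3 := condRisk_le_add (η x') (η x) (g x)
  rw [← hfx] at h2
  rw [abs_sub_comm] at h3
  linarith

end Bayes

section Grid

/-- The normals of the grid that uses the coordinate axes cyclically. -/
def gridNormals (d k : ℕ) : Matrix (Fin d) (Fin k) ℝ :=
  Matrix.of fun i j => if i.1 = j.1 % d then 1 else 0

/-- The offsets of the grid with `k / d` equidistant thresholds per axis. -/
def gridOffsets (d k : ℕ) (j : Fin k) : ℝ := -(((j.1 / d : ℕ) : ℝ) + 1) / (((k / d : ℕ) : ℝ) + 1)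

lemma grid_threshold {d k : ℕ} {x x' : EuclideanSpace ℝ (Fin d)}
    (h : signVector (gridNormals d k) (gridOffsets d k) x
      = signVector (gridNormals d k) (gridOffsets d k) x') (i : Fin d) {t : ℕ} (ht : t < k / d) :
    ((t : ℝ) + 1) / (((k / d : ℕ) : ℝ) + 1) ≤ x i ↔ ((t : ℝ) + 1) / (((k / d : ℕ) : ℝ) + 1) ≤ x' i := by
  have hd : 0 < d := i.pos
  have hj : i.1 + d * t < k := by
    calc i.1 + d * t < d + d * t := by have := i.2; omega
      _ = d * (t + 1) := by ring
      _ ≤ d * (k / d) := Nat.mul_le_mul_left _ ht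
      _ ≤ k := Nat.mul_div_le k d
  have hmod : (i.1 + d * t) % d = i.1 := by
    rw [Nat.add_mul_mod_self_left, Nat.mod_eq_of_lt i.2]
  have hdiv : (i.1 + d * t) / d = t := by
    rw [Nat.add_mul_div_left _ _ hd, Nat.div_eq_of_lt i.2, zero_add]
  have hval : ∀ y : EuclideanSpace ℝ (Fin d),
      signVector (gridNormals d k) (gridOffsets d k) y ⟨i.1 + d * t, hj⟩ = 1 ↔
        ((t : ℝ) + 1) / (((k / d : ℕ) : ℝ) + 1) ≤ y i := by
    intro y
    rw [signVector_apply, sgn_eq_one_iff]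
    simp only [gridNormals, gridOffsets, Matrix.of_apply, hmod, hdiv, Fin.val_inj, ite_mul, one_mul,
      zero_mul, Finset.sum_ite_eq', Finset.mem_univ, if_true, neg_div]
    constructor <;> intro <;> linarith
  rw [← hval, ← hval, h]

lemma grid_coord_le {m : ℕ} {a a' : ℝ} (ha : 0 ≤ a) (ha' : a' ≤ 1)
    (h : ∀ t : ℕ, t < m → (((t : ℝ) + 1) / ((m : ℝ) + 1) ≤ a ↔ ((t : ℝ) + 1) / ((m : ℝ) + 1) ≤ a')) :
    a' - a ≤ 1 / ((m : ℝ) + 1) := by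
  by_contra! hlt
  have hm : (0 : ℝ) < (m : ℝ) + 1 := by positivity
  rw [div_lt_iff₀ hm] at hlt
  have h1 := Nat.lt_floor_add_one (a * (m + 1))
  have h2 := Nat.floor_le (show 0 ≤ a * ((m : ℝ) + 1) by positivity)
  set t := ⌊a * ((m : ℝ) + 1)⌋₊
  have h3 : a' * ((m : ℝ) + 1) ≤ m + 1 := by nlinarith
  have ht : t < m := by
    have : (t : ℝ) < m := by linarith
    exact_mod_cast this
  have := (h t ht).mpr (by rw [div_le_iff₀ hm]; linarith)
  rw [div_le_iff₀ hm] at this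
  linarith

lemma norm_sub_le_of_grid {d k : ℕ} (x x' : UnitCube d)
    (h : signVector (gridNormals d k) (gridOffsets d k) x.1
      = signVector (gridNormals d k) (gridOffsets d k) x'.1) :
    ‖x.1 - x'.1‖ ≤ d / (((k / d : ℕ) : ℝ) + 1) := by
  have hi : ∀ i, |x.1 i - x'.1 i| ≤ 1 / (((k / d : ℕ) : ℝ) + 1) := fun i => by
    rw [abs_sub_le_iff]
    exact ⟨grid_coord_le (x'.2 i).1 (x.2 i).2 fun t ht => grid_threshold h.symm i ht,
      grid_coord_le (x.2 i).1 (x'.2 i).2 fun t ht => grid_threshold h i ht⟩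
  rw [EuclideanSpace.norm_eq]
  have h1 : ∑ i, ‖(x.1 - x'.1) i‖ ^ 2 ≤ (∑ i, ‖(x.1 - x'.1) i‖) ^ 2 :=
    Finset.sum_sq_le_sq_sum_of_nonneg fun i _ => norm_nonneg _
  refine (Real.sqrt_le_sqrt h1).trans ?_
  rw [Real.sqrt_sq (Finset.sum_nonneg fun i _ => norm_nonneg _)]
  refine (Finset.sum_le_card_nsmul _ _ _ fun i _ => hi i).trans (le_of_eq ?_)
  simp [div_eq_mul_inv]

/-- Arrangement classifiers approximate the Bayes risk for Lipschitz posteriors. -/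
lemma exists_cubeHAC_risk_le {d k : ℕ} {L : ℝ} (hL : 0 ≤ L) {P : Measure (UnitCube d × Label)}
    [IsProbabilityMeasure P] {η : UnitCube d → ℝ} (hηL : η ∈ lipschitzClass L d)
    (hη : IsPosterior P η) :
    ∃ f ∈ cubeHAC d d k, risk P f ≤ bayesRisk P + 2 * (L * (d / (((k / d : ℕ) : ℝ) + 1))) := by
  classical
  set v : UnitCube d → Fin k → Label :=
    fun x => signVector (gridNormals d k) (gridOffsets d k) x.1 with hv
  set h : (Fin k → Label) → Label :=
    fun p => if hp : ∃ x, v x = p then sgn (2 * η hp.choose - 1) else 1 with hh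
  refine ⟨fun x => h (v x), comp_signVector_mem_cubeHAC h _ _, ?_⟩
  refine risk_le_bayesRisk_add hη (measurable_comp_signVector h _ _) fun x => ?_
  have hx : ∃ x', v x' = v x := ⟨x, rfl⟩
  refine ⟨hx.choose, (hηL _ _).trans ?_, dif_pos hx⟩
  gcongr
  exact norm_sub_le_of_grid _ _ hx.choose_spec.symm

end Grid

/-- For `k ≤ β t` with `t ^ (d + 2) = n`, the Rademacher complexity of the arrangement classifiers
is of order `t ^ (d + 1)`. -/
lemma exists_rademacherBound {d : ℕ} (hd : 1 ≤ d) {β : ℝ} (hβ : 0 < β) :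
    ∃ K : ℝ, ∀ (n k : ℕ) (t : ℝ), 1 ≤ n → 1 ≤ t → t ^ (d + 2) = n → (k : ℝ) ≤ β * t →
      RademacherBound (HAC d d k) n (K * t ^ (d + 1)) := by
  rcases Nat.lt_or_ge d 2 with h2 | h2
  · obtain rfl : d = 1 := by omega
    refine ⟨5 / 4 + β, fun n k t hn ht htn hk => ?_⟩
    have ht0 : 0 < t := by linarith
    refine (rademacherBound_line hn ht0).mono ?_
    have h1 : (n : ℝ) / t = t ^ 2 := by rw [← htn]; field_simp
    have h3 : t * k ≤ t * (β * t) := by gcongr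
    rw [h1]
    nlinarith
  · refine ⟨β * (d + 1) * (d + 3) + (β + 1) ^ d + 1 / 2, fun n k t hn ht htn hk => ?_⟩
    have ht0 : 0 < t := by linarith
    refine (rademacherBound_HAC (l := 1 / t) (by positivity)).mono ?_
    have hn1 : (1 : ℝ) ≤ n := by exact_mod_cast hn
    have hlog : Real.log (n + 1) ≤ (d + 3) * t := by
      calc Real.log (n + 1) ≤ Real.log (2 * n) := Real.log_le_log (by positivity) (by linarith)
        _ = Real.log 2 + (d + 2) * Real.log t := by
            rw [← htn, Real.log_mul (by norm_num) (by positivity), Real.log_pow]; push_cast; ring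
        _ ≤ 1 * t + (d + 2) * t := by
            have h3 := Real.log_le_sub_one_of_pos (show (0 : ℝ) < 2 by norm_num)
            have h4 := Real.log_le_sub_one_of_pos ht0
            gcongr <;> linarith
        _ = (d + 3) * t := by ring
    have hlog0 : 0 ≤ Real.log ((n : ℝ) + 1) := Real.log_nonneg (by linarith)
    have hA : (k : ℝ) * (d + 1) * Real.log (n + 1) ≤ β * (d + 1) * (d + 3) * t ^ d := by
      calc (k : ℝ) * (d + 1) * Real.log (n + 1) ≤ β * t * (d + 1) * ((d + 3) * t) := by gcongr
        _ = β * (d + 1) * (d + 3) * t ^ 2 := by ring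
        _ ≤ _ := by gcongr
    have hB : ((k : ℝ) + 1) ^ d ≤ (β + 1) ^ d * t ^ d := by
      rw [← mul_pow]
      gcongr
      nlinarith
    have hC : (n : ℝ) * (1 / t) / 2 = 1 / 2 * t ^ (d + 1) := by
      rw [← htn]; field_simp; ring
    rw [hC, div_div_eq_mul_div, div_one]
    calc _ ≤ (β * (d + 1) * (d + 3) * t ^ d + (β + 1) ^ d * t ^ d) * t + 1 / 2 * t ^ (d + 1) := by
          gcongr
      _ = _ := by ring

end HANN

end

theorem mainTheorem3 (d : ℕ) (hd : 1 ≤ d) (L : ℝ) (hL : 0 < L) (k : ℕ → ℕ)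
    (hk : HANN.Asymp (fun n => (k n : ℝ)) (fun n => (n : ℝ) ^ (1 / ((d : ℝ) + 2)))) :
    ∃ C' : ℝ, ∀ n : ℕ, 1 ≤ n →
      ∀ fhat : (Fin n → HANN.UnitCube d × HANN.Label) → HANN.UnitCube d → HANN.Label,
        HANN.IsERM (HANN.cubeHAC d d (k n)) fhat →
        ∀ P : MeasureTheory.Measure (HANN.UnitCube d × HANN.Label),
          MeasureTheory.IsProbabilityMeasure P →
          (∃ η ∈ HANN.lipschitzClass L d, HANN.IsPosterior P η) →
          -- the risk of the learned classifier is a random variable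
          AEMeasurable (fun s => HANN.risk P (fhat s))
            (MeasureTheory.Measure.pi fun _ : Fin n => P) →
          HANN.expectedRisk P fhat - HANN.bayesRisk P ≤ C' * (n : ℝ) ^ (-(1 / ((d : ℝ) + 2))) := by
  obtain ⟨α, β, hα, hβ, hk⟩ := hk
  obtain ⟨K, hK⟩ := HANN.exists_rademacherBound hd hβ
  refine ⟨K + 2 * L * d ^ 2 / α, fun n hn fhat hfhat P hP ⟨η, hηL, hη⟩ hmeas => ?_⟩
  have hn1 : (1 : ℝ) ≤ n := by exact_mod_cast hn
  have hd0 : (0 : ℝ) < d := by exact_mod_cast hd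
  obtain ⟨hkα, hkβ⟩ := hk n hn
  rw [Real.rpow_neg (by positivity)]
  have ht : 1 ≤ (n : ℝ) ^ (1 / ((d : ℝ) + 2)) := Real.one_le_rpow hn1 (by positivity)
  have htn : ((n : ℝ) ^ (1 / ((d : ℝ) + 2))) ^ (d + 2) = n := by
    rw [← Real.rpow_natCast, ← Real.rpow_mul (by positivity)]
    push_cast
    rw [one_div_mul_cancel (by positivity), Real.rpow_one]
  set t := (n : ℝ) ^ (1 / ((d : ℝ) + 2)) with ht_def
  have ht0 : 0 < t := by linarith
  obtain ⟨f, hf, hrisk⟩ := HANN.exists_cubeHAC_risk_le (k := k n) hL.le hηL hη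
  have hest := HANN.expectedRisk_le_of_isERM P (g := HANN.rationalFamily d (k n)) hn
    (hK n (k n) t hn ht htn hkβ).cubeHAC
    (fun p => HANN.comp_signVector_mem_cubeHAC _ _ _)
    (fun p => HANN.measurable_comp_signVector _ _ _)
    (fun f hf => HANN.exists_rationalFamily_eventually_eq hf) hfhat hmeas hf
  have h1 : K * t ^ (d + 1) / n = K * t⁻¹ := by
    rw [← htn]; field_simp; ring
  have h2 : (d : ℝ) / (((k n / d : ℕ) : ℝ) + 1) ≤ d ^ 2 / α * t⁻¹ := by
    have h3 : (k n : ℝ) ≤ d * (((k n / d : ℕ) : ℝ) + 1) := by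
      have := (Nat.lt_mul_div_succ (k n) (by omega : 0 < d)).le
      exact_mod_cast this
    rw [← div_eq_mul_inv, div_div, div_le_div_iff₀ (by positivity) (by positivity)]
    calc (d : ℝ) * (α * t) ≤ d * (d * (((k n / d : ℕ) : ℝ) + 1)) := by
          exact mul_le_mul_of_nonneg_left (hkα.trans h3) hd0.le
      _ = _ := by ring
  have h4 : 2 * (L * ((d : ℝ) / (((k n / d : ℕ) : ℝ) + 1))) ≤ 2 * (L * (d ^ 2 / α * t⁻¹)) := by
    gcongr
  calc _ ≤ K * t⁻¹ + 2 * (L * (d ^ 2 / α * t⁻¹)) := by linarith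
    _ = _ := by ring
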